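/- Let $n\ge 2$, and let $G_k^{(n)}$ be the Gegenbauer polynomials defined by $G_0^{(n)}=1$, $G_1^{(n)}=t$ and $G_k^{(n)}=\dfrac{(2k+n-4)\,t\,G_{k-1}^{(n)}-(k-1)\,G_{k-2}^{(n)}}{k+n-3}$ for $k\ge 2$. Let $f$ be a real function on $[-1,1]$ that is the sum of a Gegenbauer series $f(t)=\sum_{k=0}^\infty f_k\,G_k^{(n)}(t)$ converging uniformly on $[-1,1]$, with $f_k\ge 0$ for all $k\ge 0$. For a finite set $P\subset\mathbb S^{n-1}$ (unit vectors in $\mathbb R^n$) let $D(P)=\{x\cdot y : x,y\in P,\ x\ne y\}$, let $M_k(P)=\sum_{x\in P}\sum_{y\in P}G_k^{(n)}(x\cdot y)$, and let $Z_f=\{t\in[-1,1) : f(t)=0\}$. The set $P$ is called an $f$-design if $M_k(P)=0$ for every $k>0$ with $f_k\ne 0$, and $D(P)\subset Z_f$. Theorem. Let $P\subset\mathbb S^{n-1}$ be a non-empty finite set with $|P|=m$ and $D(P)\subset Z_f$. Then $P$ is an $f$-design if and only if $f(1)=m f_0$. -/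

import Mathlib

namespace FDesign

/-- The unit sphere `S^{n-1}` in `ℝⁿ`. -/
abbrev UnitSphere (n : ℕ) : Type :=
  Metric.sphere (0 : EuclideanSpace ℝ (Fin n)) 1

/-- The Gegenbauer polynomials `G_k^{(n)}` (for `n ≥ 2`), given by `G_0 = 1`, `G_1 = t` and
`G_k = ((2k + n - 4) t G_{k-1} - (k - 1) G_{k-2}) / (k + n - 3)` for `k ≥ 2`
(the index `k` of this formula is `k + 2` in the last clause). -/
noncomputable def gegenbauer (n : ℕ) : ℕ → Polynomial ℝ
  | 0 => 1
  | 1 => Polynomial.X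
  | k + 2 =>
      Polynomial.C (((k : ℝ) + 2 + n - 3)⁻¹) *
        (Polynomial.C (2 * ((k : ℝ) + 2) + n - 4) * Polynomial.X * gegenbauer n (k + 1)
          - Polynomial.C ((k : ℝ) + 2 - 1) * gegenbauer n k)

/-- The Gegenbauer series `∑ a_k G_k^{(n)}` converges to `f` uniformly on `[-1, 1]`. -/
def HasGegenbauerExpansion (n : ℕ) (f : ℝ → ℝ) (a : ℕ → ℝ) : Prop :=
  TendstoUniformlyOn
    (fun (N : ℕ) (t : ℝ) => ∑ k ∈ Finset.range N, a k * (gegenbauer n k).eval t)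
    f Filter.atTop (Set.Icc (-1) 1)

/-- The inner product `x · y` of two points of the sphere. -/
noncomputable def dot {n : ℕ} (x y : UnitSphere n) : ℝ :=
  inner ℝ (x : EuclideanSpace ℝ (Fin n)) (y : EuclideanSpace ℝ (Fin n))

/-- The `k`-th moment `M_k(P) = ∑_{i,j} G_k^{(n)}(p_i · p_j)`, diagonal pairs included. -/
noncomputable def moment {n : ℕ} (k : ℕ) (P : Finset (UnitSphere n)) : ℝ :=
  ∑ x ∈ P, ∑ y ∈ P, (gegenbauer n k).eval (dot x y)

/-- `D(P)`: the inner products of pairs of distinct points of `P`. -/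
def innerProducts {n : ℕ} (P : Finset (UnitSphere n)) : Set ℝ :=
  {t | ∃ x ∈ P, ∃ y ∈ P, x ≠ y ∧ dot x y = t}

/-- `Z_f`: the zeros of `f` in `[-1, 1)`. -/
def zeroSet (f : ℝ → ℝ) : Set ℝ :=
  {t | t ∈ Set.Ico (-1 : ℝ) 1 ∧ f t = 0}

/-- `P` is an `f`-design, where `f = ∑ a_k G_k^{(n)}` on `[-1, 1]`. -/
structure IsFDesign {n : ℕ} (f : ℝ → ℝ) (a : ℕ → ℝ) (P : Finset (UnitSphere n)) : Prop where
  moment_eq_zero : ∀ k : ℕ, 0 < k → a k ≠ 0 → moment k P = 0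
  innerProducts_subset : innerProducts P ⊆ zeroSet f

end FDesign


/-!
Schoenberg's theorem says that the moments `M_k(P)` are nonnegative. Summing the expansion of `f`
over all pairs of points of `P` gives `∑ f(x · y) = ∑ a_k M_k(P)`. The left side is `|P| f(1)`,
because the off-diagonal inner products are zeros of `f`, and `M_0(P) = |P|²`. Hence
`f(1) = |P| a_0` means that the nonnegative terms `a_k M_k(P)` with `k > 0` add up to zero.

For Schoenberg's theorem, note that on the sphere `u ↦ G_k(x · u)` is the restriction of a
homogeneous harmonic polynomial `Z_x`. For the Fischer inner product, which makes multiplication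
by a variable adjoint to the corresponding partial derivative, `Z_x` reproduces the harmonic
polynomials of degree `k`: `⟪Z_x, h⟫ = c h(x)` with `c > 0`. Therefore
`c M_k(P) = ∑ ⟪Z_x, Z_y⟫ = ‖∑ Z_x‖² ≥ 0`.
-/

namespace FDesign

open MvPolynomial

section Fischer

variable {σ R : Type*}

/-- The factorial `α! = ∏ αᵢ!` of a multi-index. -/
def multiFactorial (α : σ →₀ ℕ) : ℕ :=
  α.prod fun _ e => e.factorial

theorem multiFactorial_single_add (i : σ) (α : σ →₀ ℕ) :
    multiFactorial (Finsupp.single i 1 + α) = (α i + 1) * multiFactorial α := by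
  have split (β : σ →₀ ℕ) : multiFactorial β = (β i).factorial * multiFactorial (β.erase i) :=
    (Finsupp.mul_prod_erase' β i (fun _ e => e.factorial) fun _ => rfl).symm
  rw [split, split α, Finsupp.erase_add, Finsupp.erase_single, zero_add, Finsupp.add_apply,
    Finsupp.single_eq_same, add_comm 1, Nat.factorial_succ, mul_assoc]

variable [CommSemiring R]

/-- The Fischer (apolar) bilinear form on polynomials: distinct monomials are orthogonal, and
`⟪X^α, X^α⟫ = α!`. -/
noncomputable def fischer : MvPolynomial σ R →ₗ[R] MvPolynomial σ R →ₗ[R] R :=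
  (basisMonomials σ R).constr R fun α => (multiFactorial α : R) • lcoeff R α

theorem fischer_monomial_left (α : σ →₀ ℕ) (c : R) (q : MvPolynomial σ R) :
    fischer (monomial α c) q = c * (multiFactorial α * q.coeff α) := by
  have h := (basisMonomials σ R).constr_basis R
    (fun α => (multiFactorial α : R) • lcoeff R α) α
  rw [coe_basisMonomials] at h
  rw [← mul_one c, ← smul_eq_mul c 1, ← smul_monomial, map_smul, fischer, h]
  simp

theorem fischer_one_left (q : MvPolynomial σ R) : fischer 1 q = q.coeff 0 := by
  rw [← C_1, ← monomial_zero', fischer_monomial_left]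
  simp [multiFactorial]

theorem fischer_self_nonneg {R : Type*} [CommRing R] [LinearOrder R] [IsStrictOrderedRing R]
    (p : MvPolynomial σ R) : 0 ≤ fischer p p := by
  have expand : fischer p p = ∑ α ∈ p.support, p.coeff α * (multiFactorial α * p.coeff α) := by
    conv_lhs => enter [1, 2]; rw [p.as_sum]
    simp only [map_sum, LinearMap.sum_apply, fischer_monomial_left]
  rw [expand]
  refine Finset.sum_nonneg fun α _ => ?_
  rw [mul_left_comm]
  exact mul_nonneg (Nat.cast_nonneg _) (mul_self_nonneg _)

theorem fischer_X_mul (i : σ) (p q : MvPolynomial σ R) :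
    fischer (X i * p) q = fischer p (pderiv i q) := by
  induction p using MvPolynomial.induction_on' with
  | monomial α c =>
    rw [X, monomial_mul, one_mul, fischer_monomial_left, fischer_monomial_left, coeff_pderiv,
      multiFactorial_single_add, add_comm α]
    push_cast
    ring
  | add p₁ p₂ h₁ h₂ => rw [mul_add, map_add, map_add, LinearMap.add_apply, h₁, h₂,
      LinearMap.add_apply]

end Fischer

section Derivatives

variable {σ R : Type*} [CommSemiring R]

theorem derivation_sum_apply {ι A M : Type*} [CommSemiring A] [Algebra R A] [AddCommMonoid M]
    [Module A M] [Module R M] (s : Finset ι) (D : ι → Derivation R A M) (a : A) :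
    (∑ i ∈ s, D i) a = ∑ i ∈ s, D i a := by
  rw [← Derivation.coeFnAddMonoidHom_apply, map_sum, Finset.sum_apply]
  rfl

theorem pderiv_pderiv_comm (i j : σ) (p : MvPolynomial σ R) :
    pderiv i (pderiv j p) = pderiv j (pderiv i p) := by
  rcases eq_or_ne i j with rfl | hij
  · rfl
  induction p using MvPolynomial.induction_on' with
  | monomial α c => simp [hij, hij.symm, tsub_right_comm, mul_right_comm]
  | add p q hp hq => simp only [map_add, hp, hq]

variable [Fintype σ]

/-- The linear form `u ↦ x · u`. -/
noncomputable def linearForm (x : σ → R) : MvPolynomial σ R :=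
  ∑ i, x i • X i

variable (σ R) in
/-- The quadratic form `u ↦ u · u`. -/
noncomputable def normSqForm : MvPolynomial σ R :=
  ∑ i, X i * X i

/-- The derivative in direction `x`. -/
noncomputable def dirDeriv (x : σ → R) :
    Derivation R (MvPolynomial σ R) (MvPolynomial σ R) :=
  ∑ i, x i • pderiv i

/-- The Laplacian `∑ ∂ᵢ²` on polynomials. -/
noncomputable def laplacian : MvPolynomial σ R →ₗ[R] MvPolynomial σ R :=
  ∑ i, (pderiv i).toLinearMap ∘ₗ (pderiv i).toLinearMap

theorem laplacian_apply (p : MvPolynomial σ R) : laplacian p = ∑ i, pderiv i (pderiv i p) := by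
  simp [laplacian, LinearMap.sum_apply]

theorem dirDeriv_apply (x : σ → R) (p : MvPolynomial σ R) :
    dirDeriv x p = ∑ i, x i • pderiv i p := by
  simp only [dirDeriv, derivation_sum_apply, Derivation.smul_apply]

theorem laplacian_dirDeriv (x : σ → R) (p : MvPolynomial σ R) :
    laplacian (dirDeriv x p) = dirDeriv x (laplacian p) := by
  simp only [laplacian_apply, dirDeriv_apply, map_sum, Derivation.map_smul]
  rw [Finset.sum_comm]
  simp only [pderiv_pderiv_comm _ _ p, pderiv_pderiv_comm _ _ (pderiv _ p)]

theorem isHomogeneous_linearForm (x : σ → R) : (linearForm x).IsHomogeneous 1 :=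
  (homogeneousSubmodule σ R 1).sum_mem fun i _ =>
    (homogeneousSubmodule σ R 1).smul_mem _ (isHomogeneous_X R i)

theorem isHomogeneous_normSqForm : (normSqForm σ R).IsHomogeneous 2 :=
  IsHomogeneous.sum _ _ _ fun i _ => (isHomogeneous_X R i).mul (isHomogeneous_X R i)

theorem eval_linearForm (x u : σ → R) : eval u (linearForm x) = x ⬝ᵥ u := by
  simp [linearForm, dotProduct, smul_eval]

theorem eval_normSqForm (u : σ → R) : eval u (normSqForm σ R) = u ⬝ᵥ u := by
  simp [normSqForm, dotProduct]

theorem pderiv_linearForm (x : σ → R) (i : σ) : pderiv i (linearForm x) = C (x i) := by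
  classical
  simp [linearForm, Pi.single_apply, smul_eq_C_mul]

theorem pderiv_normSqForm (i : σ) : pderiv i (normSqForm σ R) = 2 • X i := by
  classical
  simp [normSqForm, Pi.single_apply, Finset.sum_add_distrib, two_mul]

theorem isHomogeneous_dirDeriv (x : σ → R) {k : ℕ} {p : MvPolynomial σ R}
    (hp : p.IsHomogeneous (k + 1)) : (dirDeriv x p).IsHomogeneous k := by
  rw [dirDeriv_apply]
  exact (homogeneousSubmodule σ R k).sum_mem fun i _ =>
    (homogeneousSubmodule σ R k).smul_mem _ hp.pderiv

theorem eval_dirDeriv_self (x : σ → R) {k : ℕ} {p : MvPolynomial σ R}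
    (hp : p.IsHomogeneous k) : eval x (dirDeriv x p) = k * eval x p := by
  have euler := congrArg (eval x) hp.sum_X_mul_pderiv
  simpa [dirDeriv_apply, smul_eval] using euler

theorem dirDeriv_linearForm (x y : σ → R) : dirDeriv x (linearForm y) = C (x ⬝ᵥ y) := by
  simp [dirDeriv_apply, pderiv_linearForm, dotProduct, smul_eq_C_mul]

theorem dirDeriv_normSqForm (x : σ → R) : dirDeriv x (normSqForm σ R) = 2 • linearForm x := by
  simp only [dirDeriv_apply, pderiv_normSqForm, linearForm, Finset.smul_sum, smul_comm (2 : ℕ)]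

theorem laplacian_linearForm (x : σ → R) : laplacian (linearForm x) = 0 := by
  simp [laplacian_apply, pderiv_linearForm]

theorem laplacian_normSqForm : laplacian (normSqForm σ R) = 2 * Fintype.card σ := by
  simp only [laplacian_apply, pderiv_normSqForm, map_nsmul, pderiv_X_self]
  simp [mul_comm]

theorem laplacian_mul (p q : MvPolynomial σ R) :
    laplacian (p * q)
      = laplacian p * q + 2 • ∑ i, pderiv i p * pderiv i q + p * laplacian q := by
  simp only [laplacian_apply, pderiv_mul, map_add, Finset.mul_sum, Finset.sum_mul,
    Finset.smul_sum, ← Finset.sum_add_distrib]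
  exact Finset.sum_congr rfl fun i _ => by ring

theorem laplacian_linearForm_mul (x : σ → R) (p : MvPolynomial σ R) :
    laplacian (linearForm x * p) = 2 • dirDeriv x p + linearForm x * laplacian p := by
  simp only [laplacian_mul, laplacian_linearForm, pderiv_linearForm, dirDeriv_apply,
    smul_eq_C_mul, zero_mul, zero_add]

theorem laplacian_normSqForm_mul {k : ℕ} {p : MvPolynomial σ R} (hp : p.IsHomogeneous k) :
    laplacian (normSqForm σ R * p)
      = (4 * k + 2 * Fintype.card σ) • p + normSqForm σ R * laplacian p := by
  rw [laplacian_mul, laplacian_normSqForm]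
  simp only [pderiv_normSqForm, smul_mul_assoc, ← Finset.smul_sum, hp.sum_X_mul_pderiv]
  simp only [nsmul_eq_mul]
  push_cast
  ring

theorem fischer_linearForm_mul (x : σ → R) (p q : MvPolynomial σ R) :
    fischer (linearForm x * p) q = fischer p (dirDeriv x q) := by
  simp only [linearForm, Finset.sum_mul, smul_mul_assoc, map_sum, map_smul, LinearMap.sum_apply,
    LinearMap.smul_apply, fischer_X_mul, dirDeriv_apply]

theorem fischer_normSqForm_mul (p q : MvPolynomial σ R) :
    fischer (normSqForm σ R * p) q = fischer p (laplacian q) := by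
  simp only [normSqForm, Finset.sum_mul, mul_assoc, map_sum, LinearMap.sum_apply, fischer_X_mul,
    laplacian_apply]

end Derivatives

section Zonal

variable {σ K : Type*} [Fintype σ] [Field K]

/-- The solid zonal harmonic of degree `k` with pole `x`, obtained by making the recurrence for the
Gegenbauer polynomials bihomogeneous: for unit vectors `x` and `u` its value at `u` is
`G_k(x · u)`. -/
noncomputable def zonal (x : σ → K) : ℕ → MvPolynomial σ K
  | 0 => 1
  | 1 => linearForm x
  | k + 2 =>
      (k + Fintype.card σ - 1 : K)⁻¹ •
        ((2 * k + Fintype.card σ : K) • (linearForm x * zonal x (k + 1))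
          - ((k + 1) * (x ⬝ᵥ x)) • (normSqForm σ K * zonal x k))

theorem isHomogeneous_zonal (x : σ → K) (k : ℕ) : (zonal x k).IsHomogeneous k := by
  induction k using Nat.twoStepInduction with
  | zero => exact isHomogeneous_one σ K
  | one => exact isHomogeneous_linearForm x
  | more k h₀ h₁ =>
    have hlin := (isHomogeneous_linearForm x).mul h₁
    have hsq := (isHomogeneous_normSqForm (σ := σ) (R := K)).mul h₀
    rw [show 1 + (k + 1) = k + 2 by ring] at hlin
    rw [add_comm] at hsq
    let V := homogeneousSubmodule σ K (k + 2)
    exact V.smul_mem _ (V.sub_mem (V.smul_mem _ hlin) (V.smul_mem _ hsq))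

theorem eval_zonal {n : ℕ} {x u : Fin n → ℝ} (hx : x ⬝ᵥ x = 1) (hu : u ⬝ᵥ u = 1) (k : ℕ) :
    eval u (zonal x k) = (gegenbauer n k).eval (x ⬝ᵥ u) := by
  induction k using Nat.twoStepInduction with
  | zero => simp [zonal, gegenbauer]
  | one => simp [zonal, gegenbauer, eval_linearForm]
  | more k h₀ h₁ =>
    simp only [zonal, gegenbauer, smul_eval, eval_mul, eval_sub, eval_linearForm,
      eval_normSqForm, Polynomial.eval_mul, Polynomial.eval_sub, Polynomial.eval_C,
      Polynomial.eval_X, Fintype.card_fin, hx, hu, h₀, h₁]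
    ring

variable (K) in
/-- The value of `⟪Z, Z⟫` for the zonal harmonic `Z` of degree `k` with pole a unit vector of an
`n`-dimensional space. -/
noncomputable def zonalNormSq (n : ℕ) : ℕ → K
  | 0 => 1
  | 1 => 1
  | k + 2 => (k + n - 1 : K)⁻¹ * (2 * k + n) * (k + 2) * zonalNormSq n (k + 1)

theorem fischer_zonal_left (x : σ → K) {k : ℕ} {h : MvPolynomial σ K} (hh : h.IsHomogeneous k)
    (harm : laplacian h = 0) :
    fischer (zonal x k) h = zonalNormSq K (Fintype.card σ) k * eval x h := by
  have degree_zero {p : MvPolynomial σ K} (hp : p.IsHomogeneous 0) : p.coeff 0 = eval x p := by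
    rw [totalDegree_eq_zero_iff_eq_C.mp ((totalDegree_zero_iff_isHomogeneous _).mpr hp), eval_C,
      coeff_zero_C]
  induction k using Nat.twoStepInduction generalizing h with
  | zero => rw [zonal, zonalNormSq, fischer_one_left, degree_zero hh, one_mul]
  | one =>
    rw [zonal, zonalNormSq, one_mul, ← mul_one (linearForm x), fischer_linearForm_mul,
      fischer_one_left, degree_zero (isHomogeneous_dirDeriv x hh), eval_dirDeriv_self x hh,
      Nat.cast_one, one_mul]
  | more k _ ih =>
    have harm' : laplacian (dirDeriv x h) = 0 := by rw [laplacian_dirDeriv, harm, map_zero]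
    simp only [zonal, zonalNormSq, map_smul, map_sub, LinearMap.smul_apply, LinearMap.sub_apply,
      fischer_linearForm_mul, fischer_normSqForm_mul, harm, map_zero,
      ih (isHomogeneous_dirDeriv x hh) harm', eval_dirDeriv_self x hh, smul_eq_mul]
    push_cast
    ring

variable [CharZero K] [Nontrivial σ]

variable (σ K) in
theorem natCast_add_card_sub_one_ne_zero (k : ℕ) : (k + Fintype.card σ - 1 : K) ≠ 0 := by
  have hcard : 1 < Fintype.card σ := Fintype.one_lt_card
  rw [sub_ne_zero]
  norm_cast
  lia

theorem zonal_recurrence (x : σ → K) (k : ℕ) :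
    (k + Fintype.card σ - 1 : K) • zonal x (k + 2)
      = (2 * k + Fintype.card σ : K) • (linearForm x * zonal x (k + 1))
        - ((k + 1) * (x ⬝ᵥ x)) • (normSqForm σ K * zonal x k) := by
  rw [zonal, smul_inv_smul₀ (natCast_add_card_sub_one_ne_zero σ K k)]

theorem dirDeriv_zonal_recurrence (x : σ → K) (k : ℕ) :
    (k + Fintype.card σ - 1 : K) • dirDeriv x (zonal x (k + 2))
      = (2 * k + Fintype.card σ : K) •
          ((x ⬝ᵥ x) • zonal x (k + 1) + linearForm x * dirDeriv x (zonal x (k + 1)))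
        - ((k + 1) * (x ⬝ᵥ x)) •
          (2 • (linearForm x * zonal x k) + normSqForm σ K * dirDeriv x (zonal x k)) := by
  rw [← Derivation.map_smul, zonal_recurrence]
  simp only [map_sub, Derivation.map_smul, Derivation.leibniz, dirDeriv_linearForm,
    dirDeriv_normSqForm, C_eq_smul_one, smul_eq_mul, mul_smul_comm, mul_one,
    mul_comm (zonal x k), smul_mul_assoc]
  module

theorem dirDeriv_zonal_succ (x : σ → K) (k : ℕ) :
    dirDeriv x (zonal x (k + 1)) = ((k + 1) * (x ⬝ᵥ x)) • zonal x k := by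
  induction k using Nat.twoStepInduction with
  | zero => simp [zonal, dirDeriv_linearForm, smul_eq_C_mul]
  | one =>
    refine (smul_right_inj (natCast_add_card_sub_one_ne_zero σ K 0)).mp ?_
    rw [dirDeriv_zonal_recurrence]
    simp only [zonal, dirDeriv_linearForm, Derivation.map_one_eq_zero, C_eq_smul_one, mul_one,
      mul_zero, mul_smul_comm]
    push_cast
    module
  | more k h₀ h₁ =>
    refine (smul_right_inj (natCast_add_card_sub_one_ne_zero σ K (k + 1))).mp ?_
    rw [dirDeriv_zonal_recurrence, h₀, h₁, mul_smul_comm, mul_smul_comm]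
    push_cast
    linear_combination (norm := module) (-(k + 2) * (x ⬝ᵥ x)) • zonal_recurrence x k

theorem laplacian_zonal (x : σ → K) (k : ℕ) : laplacian (zonal x k) = 0 := by
  induction k using Nat.twoStepInduction with
  | zero => simp [zonal, laplacian_apply]
  | one => exact laplacian_linearForm x
  | more k h₀ h₁ =>
    rw [zonal, map_smul, map_sub, map_smul, map_smul, laplacian_linearForm_mul,
      laplacian_normSqForm_mul (isHomogeneous_zonal x k), h₀, h₁, dirDeriv_zonal_succ, mul_zero,
      add_zero, mul_zero, add_zero]
    module

end Zonal

section PositiveDefinite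

variable {K : Type*} [Field K] [LinearOrder K] [IsStrictOrderedRing K]

theorem zonalNormSq_pos {n : ℕ} (hn : 2 ≤ n) (k : ℕ) : 0 < zonalNormSq K n k := by
  induction k using Nat.twoStepInduction with
  | zero => exact one_pos
  | one => exact one_pos
  | more k _ ih =>
    have : (2 : K) ≤ n := by exact_mod_cast hn
    have : (0 : K) < k + n - 1 := by linarith [k.cast_nonneg (α := K)]
    rw [zonalNormSq]
    positivity

theorem sum_sum_mul_eval_zonal_nonneg {σ ι : Type*} [Fintype σ] [Nontrivial σ] (s : Finset ι)
    (x : ι → σ → K) (w : ι → K) (k : ℕ) :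
    0 ≤ ∑ i ∈ s, ∑ j ∈ s, w i * w j * eval (x i) (zonal (x j) k) := by
  let Z : MvPolynomial σ K := ∑ i ∈ s, w i • zonal (x i) k
  have norm_sq : fischer Z Z = zonalNormSq K (Fintype.card σ) k *
      ∑ i ∈ s, ∑ j ∈ s, w i * w j * eval (x i) (zonal (x j) k) := by
    simp only [Z, map_sum, LinearMap.sum_apply, map_smul, LinearMap.smul_apply, smul_eq_mul,
      fischer_zonal_left _ (isHomogeneous_zonal _ k) (laplacian_zonal _ k), Finset.mul_sum]
    rw [Finset.sum_comm]
    exact Finset.sum_congr rfl fun i _ => Finset.sum_congr rfl fun j _ => by ring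
  have hcard : 2 ≤ Fintype.card σ := Fintype.one_lt_card
  exact nonneg_of_mul_nonneg_right (norm_sq ▸ fischer_self_nonneg Z) (zonalNormSq_pos hcard k)

end PositiveDefinite

theorem eq_apply_zero_iff_of_hasSum_of_nonneg {M : Type*} [AddCommGroup M] [PartialOrder M]
    [IsOrderedAddMonoid M] [TopologicalSpace M] [IsTopologicalAddGroup M] [OrderClosedTopology M]
    {b : ℕ → M} {s : M} (hb : ∀ k, 0 ≤ b k) (hs : HasSum b s) :
    s = b 0 ↔ ∀ k, 0 < k → b k = 0 := by
  have tail : HasSum (fun k => b (k + 1)) (s - b 0) := by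
    simpa using (hasSum_nat_add_iff' 1).mpr hs
  rw [← sub_eq_zero]
  constructor
  · intro h k hk
    rw [h, hasSum_zero_iff_of_nonneg fun k => hb (k + 1)] at tail
    simpa [Nat.sub_add_cancel hk] using congrFun tail (k - 1)
  · intro h
    simp only [h _ (Nat.succ_pos _)] at tail
    exact tail.unique hasSum_zero

section Moments

variable {n : ℕ}

theorem dot_eq_dotProduct (x y : UnitSphere n) : dot x y = x.1.ofLp ⬝ᵥ y.1.ofLp := by
  rw [dot, EuclideanSpace.inner_eq_star_dotProduct, star_trivial, dotProduct_comm]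

theorem dot_self (x : UnitSphere n) : dot x x = 1 := by
  simp [dot]

theorem dot_mem_Icc (x y : UnitSphere n) : dot x y ∈ Set.Icc (-1 : ℝ) 1 := by
  have h := abs_real_inner_le_norm (x : EuclideanSpace ℝ (Fin n)) y
  rw [norm_eq_of_mem_sphere, norm_eq_of_mem_sphere, one_mul] at h
  exact abs_le.mp h

theorem eval_zonal_eq_eval_dot (x y : UnitSphere n) (k : ℕ) :
    eval x.1.ofLp (zonal y.1.ofLp k) = (gegenbauer n k).eval (dot x y) := by
  rw [eval_zonal, dot_eq_dotProduct, dotProduct_comm] <;> rw [← dot_eq_dotProduct, dot_self]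

theorem moment_nonneg (hn : 2 ≤ n) (k : ℕ) (P : Finset (UnitSphere n)) : 0 ≤ moment k P := by
  have : Nontrivial (Fin n) := Fin.nontrivial_iff_two_le.mpr hn
  simpa only [moment, one_mul, Pi.one_apply, eval_zonal_eq_eval_dot] using
    sum_sum_mul_eval_zonal_nonneg P (fun x => x.1.ofLp) 1 k

theorem moment_zero (P : Finset (UnitSphere n)) : moment 0 P = (P.card : ℝ) ^ 2 := by
  simp [moment, gegenbauer, sq]

theorem sum_sum_apply_dot {f : ℝ → ℝ} {P : Finset (UnitSphere n)}
    (hD : innerProducts P ⊆ zeroSet f) : ∑ x ∈ P, ∑ y ∈ P, f (dot x y) = P.card * f 1 := by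
  have row (x) (hx : x ∈ P) : ∑ y ∈ P, f (dot x y) = f 1 := by
    rw [Finset.sum_eq_single_of_mem x hx fun y hy hyx => (hD ⟨x, hx, y, hy, hyx.symm, rfl⟩).2,
      dot_self]
  rw [Finset.sum_congr rfl row, Finset.sum_const, nsmul_eq_mul]

variable {f : ℝ → ℝ} {a : ℕ → ℝ}

theorem HasGegenbauerExpansion.tendsto_sum_mul_moment (hf : HasGegenbauerExpansion n f a)
    (P : Finset (UnitSphere n)) :
    Filter.Tendsto (fun N => ∑ k ∈ Finset.range N, a k * moment k P) Filter.atTop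
      (nhds (∑ x ∈ P, ∑ y ∈ P, f (dot x y))) := by
  refine (tendsto_finsetSum P fun x _ => tendsto_finsetSum P fun y _ =>
    hf.tendsto_at (dot_mem_Icc x y)).congr fun N => ?_
  simp only [moment, Finset.mul_sum]
  rw [Finset.sum_comm (s := Finset.range N)]
  exact Finset.sum_congr rfl fun x _ => Finset.sum_comm

theorem HasGegenbauerExpansion.hasSum_mul_moment (hn : 2 ≤ n)
    (hf : HasGegenbauerExpansion n f a) (ha : ∀ k, 0 ≤ a k) (P : Finset (UnitSphere n)) :
    HasSum (fun k => a k * moment k P) (∑ x ∈ P, ∑ y ∈ P, f (dot x y)) :=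
  (hasSum_iff_tendsto_nat_of_nonneg (fun k => mul_nonneg (ha k) (moment_nonneg hn k P)) _).mpr
    (hf.tendsto_sum_mul_moment P)

theorem HasGegenbauerExpansion.sum_sum_apply_dot_eq_iff (hn : 2 ≤ n)
    (hf : HasGegenbauerExpansion n f a) (ha : ∀ k, 0 ≤ a k) (P : Finset (UnitSphere n)) :
    ∑ x ∈ P, ∑ y ∈ P, f (dot x y) = (P.card : ℝ) ^ 2 * a 0
      ↔ ∀ k, 0 < k → a k ≠ 0 → moment k P = 0 := by
  have h := eq_apply_zero_iff_of_hasSum_of_nonneg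
    (fun k => mul_nonneg (ha k) (moment_nonneg hn k P)) (hf.hasSum_mul_moment hn ha P)
  simpa only [moment_zero, mul_eq_zero, or_iff_not_imp_left, mul_comm (a 0), ne_eq] using h

end Moments

end FDesign

theorem mainTheorem5 (n : ℕ) (hn : 2 ≤ n) (f : ℝ → ℝ) (a : ℕ → ℝ)
    (hf : FDesign.HasGegenbauerExpansion n f a) (ha : ∀ k : ℕ, 0 ≤ a k)
    (m : ℕ) (P : Finset (FDesign.UnitSphere n)) (hP : P.Nonempty) (hm : P.card = m)
    (hD : FDesign.innerProducts P ⊆ FDesign.zeroSet f) :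
    FDesign.IsFDesign f a P ↔ f 1 = (m : ℝ) * a 0 := by
  subst hm
  have hcard : (P.card : ℝ) ≠ 0 := by exact_mod_cast hP.card_ne_zero
  calc FDesign.IsFDesign f a P
    _ ↔ ∀ k, 0 < k → a k ≠ 0 → FDesign.moment k P = 0 := ⟨fun h => h.1, fun h => ⟨h, hD⟩⟩
    _ ↔ ∑ x ∈ P, ∑ y ∈ P, f (FDesign.dot x y) = (P.card : ℝ) ^ 2 * a 0 :=
      (hf.sum_sum_apply_dot_eq_iff hn ha P).symm
    _ ↔ f 1 = P.card * a 0 := by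
      rw [FDesign.sum_sum_apply_dot hD, sq, mul_assoc, mul_right_inj' hcard]
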